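/- For $\mu\in\mathbb R$, $\eta>0$ and $\rho>0$, let $\mathcal{DTN}(\mu,\eta^2,\rho)$ denote the symmetric doubly truncated normal distribution, i.e. the distribution on $\mathbb R$ with density $$f(x)=\frac1\eta\,\frac{\phi\left(\frac{x-\mu}{\eta}\right)}{\Phi(\rho)-\Phi(-\rho)}\quad\text{for } x\in[\mu-\rho\eta,\ \mu+\rho\eta],\qquad f(x)=0\ \text{ otherwise},$$ where $\phi$ and $\Phi$ are the density and the cumulative distribution function of the standard normal distribution. Let $x_1,x_2,\ldots$ be independent random variables on a probability space with $x_i\sim\mathcal{DTN}(\mu_i,\eta_i^2,\rho_i)$, where the $\mu_i$ are (finite) real numbers, and suppose that there are constants $\underline\rho>0$ and $0<\underline\eta\le\overline\eta<\infty$ such that $\rho_i\ge\underline\rho$ and $\underline\eta\le\eta_i\le\overline\eta$ for all $i$. Let $\beta_1,\beta_2,\ldots$ be real numbers for which there are constants $\underline\beta,\overline\beta$ with $0<\underline\beta\le|\beta_i|\le\overline\beta<\infty$ for all $i$. Then, as $n\to\infty$, $$\frac1{t_n}\sum_{i=1}^n\beta_i(x_i-\mu_i)\ \xrightarrow{d}\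 \mathcal N(0,1),\qquad\text{where } t_n=\Big(\sum_{i=1}^n\beta_i^2\,\mathrm{Var}[x_i]\Big)^{1/2}.$$ -/

import Mathlib

open MeasureTheory ProbabilityTheory Filter

/-- The standard normal density `φ(ξ) = exp (-ξ² / 2) / √(2π)`. -/
noncomputable def stdNormalPDF (ξ : ℝ) : ℝ :=
  1 / Real.sqrt (2 * Real.pi) * Real.exp (-(1 / 2) * ξ ^ 2)

/-- The standard normal cumulative distribution function `Φ(z) = ∫_{-∞}^z φ(ξ) dξ`. -/
noncomputable def stdNormalCDF (z : ℝ) : ℝ :=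
  ∫ ξ in Set.Iic z, stdNormalPDF ξ

/-- The density of the truncated normal distribution `TN(μ, η², [a, b])` with location `μ`,
scale `η > 0` and (finite) truncation bounds `a < b`. -/
noncomputable def truncNormalPDF (μ η a b : ℝ) (x : ℝ) : ℝ :=
  open Classical in
  if x ∈ Set.Icc a b then
    1 / η * (stdNormalPDF ((x - μ) / η)
      / (stdNormalCDF ((b - μ) / η) - stdNormalCDF ((a - μ) / η)))
  else 0

/-- The truncated normal distribution `TN(μ, η², [a, b])`, as a measure on `ℝ`. -/
noncomputable def truncNormal (μ η a b : ℝ) : Measure ℝ :=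
  volume.withDensity fun x => ENNReal.ofReal (truncNormalPDF μ η a b x)

/-- The symmetric doubly truncated normal distribution
`DTN(μ, η², ρ) = TN(μ, η², [μ - ρ η, μ + ρ η])`, for `η > 0` and `ρ > 0`.
The second argument is the scale `η` itself, not `η²`. -/
noncomputable def doublyTruncNormal (μ η ρ : ℝ) : Measure ℝ :=
  truncNormal μ η (μ - ρ * η) (μ + ρ * η)

/-! The argument is a Lyapunov-type central limit theorem, proved with characteristic functions.
Standardizing `x i` gives a standard normal conditioned on `[-ρ i, ρ i]`, which is centered. As `ρ i
≥ ρ_low`, its third absolute moment is bounded above and its variance bounded away from zero,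
uniformly in `i`; the bounds on `β` and `η` transfer this to the summands `β i * (x i - μ i)`. Hence
`t_n ≥ √(n v)`. At the frequency `s = t / t_n`, of order `n^(-1/2)`, each characteristic function is
within `O(n^(-3/2))` of that of the Gaussian with the same variance (`norm_charFun_sub_exp_le`).
Products of numbers in the unit disc differ by at most the sum of the factorwise differences, so the
total error is `O(n^(-1/2))`. -/

/-! ### Elementary inequalities. -/

lemma norm_prod_sub_prod_le_sum {ι : Type*} (s : Finset ι) (f g : ι → ℂ)
    (hf : ∀ i ∈ s, ‖f i‖ ≤ 1) (hg : ∀ i ∈ s, ‖g i‖ ≤ 1) :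
    ‖∏ i ∈ s, f i - ∏ i ∈ s, g i‖ ≤ ∑ i ∈ s, ‖f i - g i‖ := by
  classical
  induction s using Finset.induction_on with
  | empty => simp
  | insert a s ha ih =>
    rw [Finset.prod_insert ha, Finset.prod_insert ha, Finset.sum_insert ha]
    have hs := ih (fun i hi => hf i (Finset.mem_insert_of_mem hi))
      (fun i hi => hg i (Finset.mem_insert_of_mem hi))
    have hprod : ‖∏ i ∈ s, f i‖ ≤ 1 := by
      rw [norm_prod]
      exact Finset.prod_le_one (fun _ _ => norm_nonneg _)
        (fun i hi => hf i (Finset.mem_insert_of_mem hi))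
    have hga := hg a (Finset.mem_insert_self a s)
    -- Telescoping: one factor is swapped at a time.
    calc ‖f a * ∏ i ∈ s, f i - g a * ∏ i ∈ s, g i‖
        = ‖(f a - g a) * ∏ i ∈ s, f i + g a * (∏ i ∈ s, f i - ∏ i ∈ s, g i)‖ := by
          congr 1; ring
      _ ≤ ‖f a - g a‖ * ‖∏ i ∈ s, f i‖ + ‖g a‖ * ‖∏ i ∈ s, f i - ∏ i ∈ s, g i‖ := by
          rw [← norm_mul, ← norm_mul]; exact norm_add_le _ _
      _ ≤ ‖f a - g a‖ * 1 + 1 * ∑ i ∈ s, ‖f i - g i‖ := by gcongr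
      _ = _ := by ring

/-- For `|x| ≤ 1` this is the exponential series remainder; for `|x| ≥ 1` every term is dominated by
`|x| ^ 3`. The constant 4 is not sharp. -/
lemma norm_cexp_mul_I_sub_taylor_two_le (x : ℝ) :
    ‖Complex.exp (x * Complex.I) - (1 + x * Complex.I - x ^ 2 / 2)‖ ≤ 4 * |x| ^ 3 := by
  have hn : ‖(x * Complex.I : ℂ)‖ = |x| := by simp
  have hI : (x * Complex.I : ℂ) ^ 2 = -(x : ℂ) ^ 2 := by
    rw [mul_pow, Complex.I_sq]; ring
  rcases le_total |x| 1 with hx | hx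
  · have h := Complex.exp_bound (x := x * Complex.I) (by rwa [hn]) (n := 3) (by norm_num)
    rw [hn] at h
    simp only [Finset.sum_range_succ, Finset.range_one, Finset.sum_singleton, hI] at h
    norm_num [Nat.factorial] at h
    calc _ = ‖Complex.exp (x * Complex.I) - (1 + x * Complex.I + -(x : ℂ) ^ 2 / 2)‖ := by
          congr 1; ring
      _ ≤ _ := h
      _ ≤ _ := by nlinarith [pow_nonneg (abs_nonneg x) 3]
  · have h1 : ‖Complex.exp (x * Complex.I)‖ = 1 := Complex.norm_exp_ofReal_mul_I x
    have h2 : ‖(x : ℂ) ^ 2 / 2‖ = |x| ^ 2 / 2 := by simp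
    calc _ ≤ ‖Complex.exp (x * Complex.I)‖ + (‖(1 : ℂ)‖ + ‖(x * Complex.I : ℂ)‖
            + ‖(x : ℂ) ^ 2 / 2‖) :=
          (norm_sub_le _ _).trans (add_le_add_right
            ((norm_sub_le _ _).trans (add_le_add_left (norm_add_le _ _) _)) _)
      _ = 2 + |x| + |x| ^ 2 / 2 := by rw [h1, h2, hn, norm_one]; ring
      _ ≤ 4 * |x| ^ 3 := by
          nlinarith [mul_nonneg (sub_nonneg.2 hx) (sub_nonneg.2 hx), pow_two_nonneg |x|,
            mul_nonneg (sub_nonneg.2 hx) (pow_two_nonneg |x|)]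

lemma abs_exp_neg_sub_one_add_le_sq {y : ℝ} (hy : 0 ≤ y) :
    |Real.exp (-y) - (1 - y)| ≤ y ^ 2 := by
  rcases le_total y 1 with h | h
  · have := Real.abs_exp_sub_one_sub_id_le (x := -y) (by rwa [abs_neg, abs_of_nonneg hy])
    rw [neg_sq] at this
    convert this using 2
    ring
  · have h1 := Real.add_one_le_exp (-y)
    have h2 : Real.exp (-y) ≤ 1 := Real.exp_le_one_iff.2 (by linarith)
    rw [abs_le]
    constructor <;> nlinarith

/-! ### Central limit theorem under bounded third moments. -/

section CLT

variable {Ω : Type*} [MeasurableSpace Ω] {P : Measure Ω} [IsProbabilityMeasure P]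

/-- On a probability space lower moments are controlled by `y ≤ 1 + y ^ 3` and `y ^ 2 ≤ 1 + y ^ 3`
for `y ≥ 0`. -/
lemma integrable_of_integrable_abs_cube {Y : Ω → ℝ} (hY : AEMeasurable Y P)
    (h3 : Integrable (fun ω => |Y ω| ^ 3) P) : Integrable Y P := by
  refine ((integrable_const (1 : ℝ)).add h3).mono' hY.aestronglyMeasurable (.of_forall fun ω => ?_)
  have := abs_nonneg (Y ω)
  simp only [Pi.add_apply, Real.norm_eq_abs]
  nlinarith [mul_nonneg this (sq_nonneg (|Y ω| - 1)), sq_nonneg (|Y ω| - 1)]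

lemma integrable_sq_of_integrable_abs_cube {Y : Ω → ℝ} (hY : AEMeasurable Y P)
    (h3 : Integrable (fun ω => |Y ω| ^ 3) P) : Integrable (fun ω => Y ω ^ 2) P := by
  refine ((integrable_const (1 : ℝ)).add h3).mono' (hY.pow_const 2).aestronglyMeasurable
    (.of_forall fun ω => ?_)
  have := abs_nonneg (Y ω)
  simp only [Pi.add_apply, Real.norm_eq_abs, abs_pow]
  nlinarith [mul_nonneg this (sq_nonneg (|Y ω| - 1)), sq_nonneg (|Y ω| - 1)]

lemma integral_sq_le_of_integrable_abs_cube {Y : Ω → ℝ} (hY : AEMeasurable Y P)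
    (h3 : Integrable (fun ω => |Y ω| ^ 3) P) :
    ∫ ω, Y ω ^ 2 ∂P ≤ 1 + ∫ ω, |Y ω| ^ 3 ∂P := by
  have h1 : ∫ ω, (1 + |Y ω| ^ 3) ∂P = 1 + ∫ ω, |Y ω| ^ 3 ∂P := by
    rw [integral_add (integrable_const _) h3]; simp
  rw [← h1]
  refine integral_mono (integrable_sq_of_integrable_abs_cube hY h3)
    ((integrable_const (1 : ℝ)).add h3) fun ω => ?_
  have := abs_nonneg (Y ω)
  simp only
  rw [← sq_abs]
  nlinarith [mul_nonneg this (sq_nonneg (|Y ω| - 1)), sq_nonneg (|Y ω| - 1)]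

/-- Second order Taylor bound for the characteristic function of a centered variable. -/
lemma norm_charFun_sub_taylor_two_le {Y : Ω → ℝ} (hY : AEMeasurable Y P)
    (h3 : Integrable (fun ω => |Y ω| ^ 3) P) (h0 : ∫ ω, Y ω ∂P = 0) (s : ℝ) :
    ‖charFun (P.map Y) s - (1 - s ^ 2 * (∫ ω, Y ω ^ 2 ∂P : ℝ) / 2)‖
      ≤ 4 * |s| ^ 3 * ∫ ω, |Y ω| ^ 3 ∂P := by
  have hi1 : Integrable (fun ω => (Y ω : ℂ)) P := (integrable_of_integrable_abs_cube hY h3).ofReal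
  have hi2 : Integrable (fun ω => ((Y ω ^ 2 : ℝ) : ℂ)) P :=
    (integrable_sq_of_integrable_abs_cube hY h3).ofReal
  have hiexp : Integrable (fun ω => Complex.exp ((s * Y ω : ℝ) * Complex.I)) P := by
    refine (integrable_const (1 : ℝ)).mono' ?_ (.of_forall fun ω => ?_)
    · exact (Complex.measurable_exp.comp_aemeasurable
        ((Complex.measurable_ofReal.comp_aemeasurable
          (hY.const_mul s)).mul_const _)).aestronglyMeasurable
    · rw [Complex.norm_exp_ofReal_mul_I]
  have hc : charFun (P.map Y) s = ∫ ω, Complex.exp ((s * Y ω : ℝ) * Complex.I) ∂P := by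
    rw [charFun_apply_real, integral_map hY (by fun_prop)]
    simp
  have hiT : Integrable (fun ω => (1 + s * Complex.I * (Y ω : ℂ)
      - s ^ 2 / 2 * ((Y ω ^ 2 : ℝ) : ℂ))) P :=
    ((integrable_const (1 : ℂ)).add (hi1.const_mul _)).sub (hi2.const_mul _)
  have hT : (1 - s ^ 2 * (∫ ω, Y ω ^ 2 ∂P : ℝ) / 2 : ℂ)
      = ∫ ω, (1 + s * Complex.I * (Y ω : ℂ) - s ^ 2 / 2 * ((Y ω ^ 2 : ℝ) : ℂ)) ∂P := by
    have hi : Integrable (fun ω => 1 + s * Complex.I * (Y ω : ℂ)) P :=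
      (integrable_const (1 : ℂ)).add (hi1.const_mul _)
    rw [integral_sub hi (hi2.const_mul _),
      integral_add (integrable_const (1 : ℂ)) (hi1.const_mul _), integral_const_mul,
      integral_const_mul, integral_complex_ofReal, integral_complex_ofReal, h0]
    simp
    ring
  rw [hc, hT, ← integral_sub hiexp hiT, ← integral_const_mul]
  refine norm_integral_le_of_norm_le (h3.const_mul _) (.of_forall fun ω => ?_)
  have := norm_cexp_mul_I_sub_taylor_two_le (s * Y ω)
  rw [abs_mul, mul_pow, ← mul_assoc] at this
  refine le_trans (le_of_eq ?_) this
  congr 1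
  push_cast
  ring

/-- Comparison of the characteristic function of a centered variable with the one of the Gaussian
of the same variance. -/
lemma norm_charFun_sub_exp_le {Y : Ω → ℝ} (hY : AEMeasurable Y P) {M b s : ℝ}
    (h3 : Integrable (fun ω => |Y ω| ^ 3) P) (hM : ∫ ω, |Y ω| ^ 3 ∂P ≤ M)
    (h0 : ∫ ω, Y ω ∂P = 0) (hs : |s| ≤ b) :
    ‖charFun (P.map Y) s - ((Real.exp (-(s ^ 2 * variance Y P / 2)) : ℝ) : ℂ)‖
      ≤ 4 * b ^ 3 * M + (b ^ 2 * (1 + M)) ^ 2 := by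
  have hb : 0 ≤ b := (abs_nonneg s).trans hs
  have hv0 := variance_nonneg Y P
  have hsq := variance_of_integral_eq_zero hY h0
  have hup : variance Y P ≤ 1 + M := by
    rw [hsq]
    exact (integral_sq_le_of_integrable_abs_cube hY h3).trans (by linarith)
  have h1 := norm_charFun_sub_taylor_two_le hY h3 h0 s
  rw [← hsq] at h1
  have hM0 : 0 ≤ ∫ ω, |Y ω| ^ 3 ∂P := integral_nonneg fun ω => by positivity
  have hb1 : 4 * |s| ^ 3 * ∫ ω, |Y ω| ^ 3 ∂P ≤ 4 * b ^ 3 * M := by gcongr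
  have hs2 : s ^ 2 ≤ b ^ 2 := sq_le_sq.2 (by rwa [abs_of_nonneg hb])
  have hy0 : 0 ≤ s ^ 2 * variance Y P / 2 := by positivity
  have hy : s ^ 2 * variance Y P / 2 ≤ b ^ 2 * (1 + M) :=
    (half_le_self (by positivity)).trans (mul_le_mul hs2 hup hv0 (sq_nonneg b))
  have h2 : ‖(1 - s ^ 2 * (variance Y P : ℝ) / 2 : ℂ)
      - ((Real.exp (-(s ^ 2 * variance Y P / 2)) : ℝ) : ℂ)‖ ≤ (b ^ 2 * (1 + M)) ^ 2 := by
    refine le_trans (le_of_eq ?_)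
      ((abs_exp_neg_sub_one_add_le_sq hy0).trans (pow_le_pow_left₀ hy0 hy 2))
    rw [← Real.norm_eq_abs, ← Complex.norm_real, norm_sub_rev]
    push_cast
    rfl
  exact (norm_sub_le_norm_sub_add_norm_sub _ _ _).trans
    (add_le_add (h1.trans hb1) h2)

/-- **Central limit theorem** for independent centered variables whose third absolute moments are
bounded and whose variances are bounded away from zero. -/
theorem tendstoInDistribution_sum_of_abs_cube_le {X : ℕ → Ω → ℝ} {M v : ℝ}
    (hX : ∀ i, AEMeasurable (X i) P) (hindep : iIndepFun X P)
    (h3 : ∀ i, Integrable (fun ω => |X i ω| ^ 3) P) (hM : ∀ i, ∫ ω, |X i ω| ^ 3 ∂P ≤ M)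
    (h0 : ∀ i, ∫ ω, X i ω ∂P = 0) (hv : 0 < v) (hvar : ∀ i, v ≤ variance (X i) P) :
    TendstoInDistribution
      (fun (n : ℕ) ω => 1 / √(∑ i ∈ Finset.range n, variance (X i) P)
        * ∑ i ∈ Finset.range n, X i ω)
      atTop (id : ℝ → ℝ) (fun _ => P) (gaussianReal 0 1) where
  forall_aemeasurable n := (Finset.aemeasurable_fun_sum _ fun i _ => hX i).const_mul _
  aemeasurable_limit := aemeasurable_id
  tendsto := by
    refine ProbabilityMeasure.tendsto_iff_tendsto_charFun.2 fun t => ?_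
    simp only [ProbabilityMeasure.coe_mk, Measure.map_id]
    -- Chosen so that `|s| ≤ a / √n`, by `S ≥ n v`.
    set a : ℝ := |t| / √v with ha
    have ha0 : 0 ≤ a := by positivity
    have hlim : Tendsto (fun n : ℕ => 4 * M * a ^ 3 * (√n)⁻¹
        + (1 + M) ^ 2 * a ^ 4 * ((√n)⁻¹) ^ 2) atTop (nhds 0) := by
      have h : Tendsto (fun n : ℕ => (√(n : ℝ))⁻¹) atTop (nhds 0) :=
        tendsto_inv_atTop_zero.comp (Real.tendsto_sqrt_atTop.comp tendsto_natCast_atTop_atTop)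
      simpa using (h.const_mul (4 * M * a ^ 3)).add ((h.pow 2).const_mul ((1 + M) ^ 2 * a ^ 4))
    rw [tendsto_iff_norm_sub_tendsto_zero]
    refine squeeze_zero' (.of_forall fun _ => norm_nonneg _) ?_ hlim
    filter_upwards [eventually_ge_atTop 1] with n hn
    have hn0 : (0 : ℝ) < n := by exact_mod_cast hn
    set S : ℝ := ∑ i ∈ Finset.range n, variance (X i) P with hS
    have hSv : n * v ≤ S := by
      rw [hS]
      simpa using Finset.card_nsmul_le_sum (Finset.range n) (fun i => variance (X i) P) v
        (fun i _ => hvar i)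
    have hS0 : 0 < S := (mul_pos hn0 hv).trans_le hSv
    set s : ℝ := 1 / √S * t with hs
    have hsS : s ^ 2 * S = t ^ 2 := by
      rw [hs, mul_pow, div_pow, Real.sq_sqrt hS0.le]; field_simp
    have hs_le : |s| ≤ a * (√n)⁻¹ := by
      have : √n * √v ≤ √S := by
        rw [← Real.sqrt_mul hn0.le]; exact Real.sqrt_le_sqrt hSv
      have hpos : 0 < √n * √v := by positivity
      rw [hs, abs_mul, abs_of_nonneg (by positivity), ha]
      calc 1 / √S * |t| ≤ 1 / (√n * √v) * |t| := by gcongr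
        _ = _ := by field_simp
    have hchar : charFun (P.map fun ω => 1 / √S * ∑ i ∈ Finset.range n, X i ω) t
        = ∏ i ∈ Finset.range n, charFun (P.map (X i)) s := by
      rw [charFun_map_mul_comp,
        (hindep.restrict _).charFun_map_fun_finsetSum_eq_prod (fun _ _ => hX _)]
      · simp [hs]
      · exact Finset.aemeasurable_fun_sum _ fun _ _ => hX _
    -- Since `s ^ 2 * S = t ^ 2`, the limit splits exactly into Gaussian factors with matching
    -- variances.
    have hgauss : charFun (gaussianReal 0 1) t
        = ∏ i ∈ Finset.range n, ((Real.exp (-(s ^ 2 * variance (X i) P / 2)) : ℝ) : ℂ) := by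
      rw [charFun_gaussianReal, ← Complex.ofReal_prod, ← Real.exp_sum, Finset.sum_neg_distrib,
        ← Finset.sum_div, ← Finset.mul_sum, ← hS, hsS]
      push_cast
      congr 1
      simp
    rw [hchar, hgauss]
    calc _ ≤ ∑ i ∈ Finset.range n, ‖charFun (P.map (X i)) s
            - ((Real.exp (-(s ^ 2 * variance (X i) P / 2)) : ℝ) : ℂ)‖ := by
          refine norm_prod_sub_prod_le_sum _ _ _ (fun i _ => ?_) (fun i _ => ?_)
          · have := Measure.isProbabilityMeasure_map (hX i)
            exact norm_charFun_le_one _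
          · rw [Complex.norm_real, Real.norm_eq_abs, Real.abs_exp, Real.exp_le_one_iff]
            have := variance_nonneg (X i) P
            have : 0 ≤ s ^ 2 * variance (X i) P / 2 := by positivity
            linarith
      _ ≤ ∑ i ∈ Finset.range n, (4 * (a * (√n)⁻¹) ^ 3 * M
            + ((a * (√n)⁻¹) ^ 2 * (1 + M)) ^ 2) := by
          refine Finset.sum_le_sum fun i _ => ?_
          exact norm_charFun_sub_exp_le (hX i) (h3 i) (hM i) (h0 i) hs_le
      -- There are `n` equal terms, of orders `n^(-3/2)` and `n^(-2)`.
      _ = _ := by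
          rw [Finset.sum_const, Finset.card_range, nsmul_eq_mul]
          have hq : (n : ℝ) = √n ^ 2 := (Real.sq_sqrt hn0.le).symm
          have hq0 : √(n : ℝ) ≠ 0 := by positivity
          set q := √(n : ℝ)
          rw [hq]
          field_simp

end CLT

/-! ### Truncated normals as conditioned Gaussians. -/

lemma truncNormalPDF_eq_indicator {μ η a b : ℝ} (hη : 0 < η) (x : ℝ) :
    ENNReal.ofReal (truncNormalPDF μ η a b x)
      = (Set.Icc a b).indicator (fun x =>
          ENNReal.ofReal (stdNormalCDF ((b - μ) / η) - stdNormalCDF ((a - μ) / η))⁻¹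
            * gaussianPDF μ (Real.toNNReal (η ^ 2)) x) x := by
  unfold truncNormalPDF
  by_cases hx : x ∈ Set.Icc a b
  · rw [if_pos hx, Set.indicator_of_mem hx, gaussianPDF,
      ← ENNReal.ofReal_mul' (gaussianPDFReal_nonneg _ _ _)]
    congr 1
    rw [gaussianPDFReal, Real.coe_toNNReal _ (sq_nonneg η), stdNormalPDF,
      Real.sqrt_mul (by positivity) (η ^ 2), Real.sqrt_sq hη.le]
    have : -(1 / 2) * ((x - μ) / η) ^ 2 = -(x - μ) ^ 2 / (2 * η ^ 2) := by
      field_simp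
    rw [this]
    field_simp
  · rw [if_neg hx, Set.indicator_of_notMem hx, ENNReal.ofReal_zero]

lemma truncNormal_eq_smul_restrict {μ η a b : ℝ} (hη : 0 < η) :
    truncNormal μ η a b
      = ENNReal.ofReal (stdNormalCDF ((b - μ) / η) - stdNormalCDF ((a - μ) / η))⁻¹
        • (gaussianReal μ (Real.toNNReal (η ^ 2))).restrict (Set.Icc a b) := by
  have hv : Real.toNNReal (η ^ 2) ≠ 0 := by
    simpa using hη.ne'
  rw [truncNormal, funext (truncNormalPDF_eq_indicator hη), withDensity_indicator measurableSet_Icc,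
    gaussianReal_of_var_ne_zero _ hv, restrict_withDensity measurableSet_Icc,
    ← withDensity_smul _ (measurable_gaussianPDF _ _)]
  rfl

/-- The symmetric truncation of the standard normal distribution. -/
noncomputable def stdTruncNormal (ρ : ℝ) : Measure ℝ :=
  ProbabilityTheory.cond (gaussianReal 0 1) (Set.Icc (-ρ) ρ)

lemma gaussianReal_Icc_ne_zero {ρ : ℝ} (hρ : 0 < ρ) :
    gaussianReal 0 1 (Set.Icc (-ρ) ρ) ≠ 0 := by
  intro h
  have := gaussianReal_absolutelyContinuous' 0 one_ne_zero h
  rw [Real.volume_Icc, ENNReal.ofReal_eq_zero] at this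
  linarith

lemma map_standardize_doublyTruncNormal {μ η ρ : ℝ} (hη : 0 < η)
    [IsProbabilityMeasure (doublyTruncNormal μ η ρ)] :
    (doublyTruncNormal μ η ρ).map (fun x => (x - μ) / η) = stdTruncNormal ρ := by
  have hm : Measurable fun x : ℝ => (x - μ) / η := by fun_prop
  have hprob : IsProbabilityMeasure ((doublyTruncNormal μ η ρ).map fun x => (x - μ) / η) :=
    Measure.isProbabilityMeasure_map hm.aemeasurable
  have hg : (gaussianReal μ (Real.toNNReal (η ^ 2))).map (fun x => (x - μ) / η)
      = gaussianReal 0 1 := by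
    have : (fun x : ℝ => (x - μ) / η) = (fun x => x / η) ∘ (fun x => x - μ) := rfl
    rw [this, ← Measure.map_map (by fun_prop) (by fun_prop), gaussianReal_map_sub_const,
      gaussianReal_map_div_const]
    congr 1
    · simp
    · ext
      simp [Real.coe_toNNReal _ (sq_nonneg η), hη.ne']
  have hs : Set.Icc (μ - ρ * η) (μ + ρ * η) = (fun x => (x - μ) / η) ⁻¹' Set.Icc (-ρ) ρ := by
    ext x
    simp only [Set.mem_Icc, Set.mem_preimage, le_div_iff₀ hη, div_le_iff₀ hη]
    constructor <;> rintro ⟨h1, h2⟩ <;> constructor <;> linarith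
  rw [doublyTruncNormal, truncNormal_eq_smul_restrict hη, Measure.map_smul, hs,
    ← Measure.restrict_map hm measurableSet_Icc, hg] at hprob ⊢
  -- The difference of `stdNormalCDF` values need not be computed: total mass one forces the scalar
  -- to be the inverse Gaussian mass of the interval.
  have h1 := hprob.measure_univ
  simp only [Measure.smul_apply, Measure.restrict_apply_univ, smul_eq_mul] at h1
  rw [ENNReal.eq_inv_of_mul_eq_one_left h1]
  rfl

/-! ### Moments of the truncated standard normal, uniform in the truncation. -/

section Moments

variable {ρ : ℝ}

lemma integral_stdTruncNormal (f : ℝ → ℝ) :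
    ∫ x, f x ∂stdTruncNormal ρ = ((gaussianReal 0 1).real (Set.Icc (-ρ) ρ))⁻¹
      * ∫ x in Set.Icc (-ρ) ρ, f x ∂gaussianReal 0 1 := by
  rw [stdTruncNormal, ProbabilityTheory.cond, integral_smul_measure, ENNReal.toReal_inv]
  rfl

lemma integrable_stdTruncNormal (hρ : 0 < ρ) {f : ℝ → ℝ} (hf : Integrable f (gaussianReal 0 1)) :
    Integrable f (stdTruncNormal ρ) :=
  hf.restrict.smul_measure (ENNReal.inv_ne_top.2 (gaussianReal_Icc_ne_zero hρ))

lemma integrable_abs_cube_gaussianReal : Integrable (fun x : ℝ => |x| ^ 3) (gaussianReal 0 1) := by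
  simpa using (memLp_id_gaussianReal (μ := 0) (v := 1) 3).integrable_norm_pow (by norm_num)

lemma integrable_sq_gaussianReal : Integrable (fun x : ℝ => x ^ 2) (gaussianReal 0 1) :=
  (memLp_id_gaussianReal (μ := 0) (v := 1) 2).integrable_sq

lemma integral_id_stdTruncNormal : ∫ x, x ∂stdTruncNormal ρ = 0 := by
  rw [integral_stdTruncNormal]
  -- Both the Gaussian and the interval are invariant under `x ↦ -x`.
  have h : ∫ x in Set.Icc (-ρ) ρ, x ∂gaussianReal 0 1
      = -∫ x in Set.Icc (-ρ) ρ, x ∂gaussianReal 0 1 := by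
    have hneg : (gaussianReal 0 1).map (fun x => -x) = gaussianReal 0 1 := by
      simpa using gaussianReal_map_neg (μ := 0) (v := 1)
    have hpre : (fun x : ℝ => -x) ⁻¹' Set.Icc (-ρ) ρ = Set.Icc (-ρ) ρ := by
      ext x; simp only [Set.mem_preimage, Set.mem_Icc]; constructor <;> rintro ⟨_, _⟩ <;>
        constructor <;> linarith
    conv_lhs => rw [← hneg]
    rw [setIntegral_map measurableSet_Icc (by fun_prop) (by fun_prop), hpre, integral_neg]
  rw [show ∫ x in Set.Icc (-ρ) ρ, x ∂gaussianReal 0 1 = 0 by linarith, mul_zero]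

/-- Shrinking the window to `r` only decreases the normalizing mass, and the truncated integral is
at most the full one. -/
lemma integral_abs_cube_stdTruncNormal_le {r : ℝ} (hr : 0 < r) (hρ : r ≤ ρ) :
    ∫ x, |x| ^ 3 ∂stdTruncNormal ρ
      ≤ ((gaussianReal 0 1).real (Set.Icc (-r) r))⁻¹ * ∫ x, |x| ^ 3 ∂gaussianReal 0 1 := by
  have hpos : 0 < (gaussianReal 0 1).real (Set.Icc (-r) r) :=
    ENNReal.toReal_pos (gaussianReal_Icc_ne_zero hr) (measure_ne_top _ _)
  have hle : (gaussianReal 0 1).real (Set.Icc (-r) r) ≤ (gaussianReal 0 1).real (Set.Icc (-ρ) ρ) :=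
    measureReal_mono (Set.Icc_subset_Icc (by linarith) hρ)
  rw [integral_stdTruncNormal]
  have h := setIntegral_le_integral (s := Set.Icc (-ρ) ρ) integrable_abs_cube_gaussianReal
    (.of_forall fun x => by positivity)
  exact mul_le_mul (inv_anti₀ hpos hle) h (integral_nonneg fun x => by positivity)
    (inv_nonneg.2 hpos.le)

/-- The integral grows with the window, and dividing by a mass at most one only increases it. -/
lemma le_integral_sq_stdTruncNormal {r : ℝ} (hr : 0 < r) (hρ : r ≤ ρ) :
    ∫ x in Set.Icc (-r) r, x ^ 2 ∂gaussianReal 0 1 ≤ ∫ x, x ^ 2 ∂stdTruncNormal ρ := by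
  have hpos : 0 < (gaussianReal 0 1).real (Set.Icc (-ρ) ρ) :=
    ENNReal.toReal_pos (gaussianReal_Icc_ne_zero (hr.trans_le hρ)) (measure_ne_top _ _)
  have hmono : ∫ x in Set.Icc (-r) r, x ^ 2 ∂gaussianReal 0 1
      ≤ ∫ x in Set.Icc (-ρ) ρ, x ^ 2 ∂gaussianReal 0 1 :=
    setIntegral_mono_set integrable_sq_gaussianReal.integrableOn
      (.of_forall fun x => sq_nonneg x)
      (Set.Icc_subset_Icc (by linarith) hρ).eventuallyLE
  rw [integral_stdTruncNormal]
  refine hmono.trans (le_mul_of_one_le_left (integral_nonneg fun x => sq_nonneg x) ?_)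
  exact (one_le_inv₀ hpos).2 measureReal_le_one

lemma setIntegral_sq_gaussianReal_pos {r : ℝ} (hr : 0 < r) :
    0 < ∫ x in Set.Icc (-r) r, x ^ 2 ∂gaussianReal 0 1 := by
  rw [setIntegral_pos_iff_support_of_nonneg_ae (.of_forall fun x => sq_nonneg x)
    integrable_sq_gaussianReal.integrableOn, pos_iff_ne_zero]
  intro h
  have h0 := gaussianReal_absolutelyContinuous' 0 one_ne_zero h
  have hsub : Set.Ioc 0 r ⊆ (Function.support fun x : ℝ => x ^ 2) ∩ Set.Icc (-r) r := by
    intro x hx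
    exact ⟨pow_ne_zero 2 hx.1.ne', by linarith [hx.1], hx.2⟩
  have := measure_mono_null hsub h0
  rw [Real.volume_Ioc, ENNReal.ofReal_eq_zero] at this
  linarith

end Moments

/-! ### The theorem. -/

theorem corollary1 {Ω : Type*} [MeasurableSpace Ω] (P : Measure Ω) [IsProbabilityMeasure P]
    (x : ℕ → Ω → ℝ) (μ η ρ β : ℕ → ℝ) (ρ_low η_low η_up β_low β_up : ℝ)
    (hlaw : ∀ i, HasLaw (x i) (doublyTruncNormal (μ i) (η i) (ρ i)) P)
    (hindep : iIndepFun x P)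
    (hρ_low : 0 < ρ_low) (hρ : ∀ i, ρ_low ≤ ρ i)
    (hη_low : 0 < η_low) (hη : ∀ i, η_low ≤ η i ∧ η i ≤ η_up)
    (hβ_low : 0 < β_low) (hβ : ∀ i, β_low ≤ |β i| ∧ |β i| ≤ β_up) :
    TendstoInDistribution
      (fun (n : ℕ) (ω : Ω) =>
        1 / Real.sqrt (∑ i ∈ Finset.range n, β i ^ 2 * variance (x i) P)
          * ∑ i ∈ Finset.range n, β i * (x i ω - μ i))
      atTop (id : ℝ → ℝ) (fun _ => P) (gaussianReal 0 1) := by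
  have hη0 : ∀ i, 0 < η i := fun i => hη_low.trans_le (hη i).1
  have hm : ∀ i, AEMeasurable (x i) P := fun i => (hlaw i).aemeasurable
  set U : ℕ → Ω → ℝ := fun i ω => (x i ω - μ i) / η i with hU
  have hUlaw : ∀ i, HasLaw (U i) (stdTruncNormal (ρ i)) P := fun i => by
    have := (hlaw i).isProbabilityMeasure_iff.1 ‹_›
    exact HasLaw.fun_comp (Y := fun y => (y - μ i) / η i)
      ⟨by fun_prop, map_standardize_doublyTruncNormal (hη0 i)⟩ (hlaw i)
  have hint : ∀ i (f : ℝ → ℝ), Measurable f →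
      ∫ ω, f (U i ω) ∂P = ∫ y, f y ∂stdTruncNormal (ρ i) := fun i f hf => by
    rw [← (hUlaw i).map_eq, integral_map (hUlaw i).aemeasurable hf.aestronglyMeasurable]
  have hX : ∀ i ω, β i * (x i ω - μ i) = β i * η i * U i ω := fun i ω => by
    have := (hη0 i).ne'
    simp only [hU]
    field_simp
  have hvarX : ∀ i, variance (fun ω => β i * (x i ω - μ i)) P = β i ^ 2 * variance (x i) P :=
    fun i => by
      rw [variance_const_mul, variance_sub_const (hm i).aestronglyMeasurable]
  have hX0 : ∀ i, ∫ ω, β i * (x i ω - μ i) ∂P = 0 := fun i => by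
    simp_rw [hX]
    rw [integral_const_mul, hint i (fun y => y) measurable_id, integral_id_stdTruncNormal, mul_zero]
  have hcube : ∀ i ω, |β i * (x i ω - μ i)| ^ 3 = (|β i| * η i) ^ 3 * |U i ω| ^ 3 :=
    fun i ω => by rw [hX, abs_mul, abs_mul, abs_of_pos (hη0 i), mul_pow]
  -- Puts the normalization in terms of the variances of the summands themselves, as the central
  -- limit theorem requires.
  simp_rw [← hvarX]
  refine tendstoInDistribution_sum_of_abs_cube_le
    (X := fun i ω => β i * (x i ω - μ i))
    (M := (β_up * η_up) ^ 3 * (((gaussianReal 0 1).real (Set.Icc (-ρ_low) ρ_low))⁻¹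
      * ∫ y, |y| ^ 3 ∂gaussianReal 0 1))
    (v := (β_low * η_low) ^ 2 * ∫ y in Set.Icc (-ρ_low) ρ_low, y ^ 2 ∂gaussianReal 0 1)
    (fun i => ((hm i).sub_const _).const_mul _)
    (hindep.comp (fun i y => β i * (y - μ i)) fun i => by fun_prop)
    (fun i => ?_) (fun i => ?_) hX0 ?_ (fun i => ?_)
  · simp_rw [hcube]
    refine Integrable.const_mul ?_ _
    have := integrable_stdTruncNormal (hρ_low.trans_le (hρ i)) integrable_abs_cube_gaussianReal
    rw [← (hUlaw i).map_eq] at this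
    exact this.comp_aemeasurable (hUlaw i).aemeasurable
  · simp_rw [hcube]
    rw [integral_const_mul, hint i (fun y => |y| ^ 3) (by fun_prop)]
    have h1 := integral_abs_cube_stdTruncNormal_le hρ_low (hρ i)
    have h2 : 0 ≤ ∫ y, |y| ^ 3 ∂stdTruncNormal (ρ i) := integral_nonneg fun y => by positivity
    have := hη0 i
    have hβ' := (hβ i).2
    have hη' := (hη i).2
    have : 0 ≤ β_up := (abs_nonneg _).trans hβ'
    have : 0 ≤ η_up := (hη0 i).le.trans hη'
    have : 0 ≤ (β_up * η_up) ^ 3 := by positivity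
    gcongr
  · exact mul_pos (by positivity) (setIntegral_sq_gaussianReal_pos hρ_low)
  · rw [variance_of_integral_eq_zero (((hm i).sub_const _).const_mul _) (hX0 i)]
    have hsq : ∀ ω, (β i * (x i ω - μ i)) ^ 2 = (|β i| * η i) ^ 2 * U i ω ^ 2 := fun ω => by
      rw [hX, mul_pow, mul_pow, mul_pow, sq_abs]
    simp_rw [hsq]
    rw [integral_const_mul, hint i (fun y => y ^ 2) (by fun_prop)]
    have h1 := le_integral_sq_stdTruncNormal hρ_low (hρ i)
    have h2 := setIntegral_sq_gaussianReal_pos hρ_low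
    have hβ' := (hβ i).1
    have hη' := (hη i).1
    gcongr
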